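/- Let $X$ be a finite alphabet with $|X|\ge 2$ and let $X^*$ be the set of finite words over $X$. A self-similar group over $X$ is a group $G$ with a faithful action on $X^*$ by length-preserving permutations such that for all $g\in G$, $x\in X$ there is $g|_x\in G$ (the section of $g$ at $x$) with $g(xw)=g(x)\,g|_x(w)$ for all $w\in X^*$; for words put $g|_{\varepsilon}=g$ and $g|_{xv}=(g|_x)|_v$. An automaton in $G$ is a finite subset of $G$ closed under taking sections. The group $G$ is contracting if there is an automaton $N\subseteq G$ such that for every $g\in G$ there is $n\ge 0$ with $g|_w\in N$ for all words $w$ of length $n$; the smallest such $N$ is the nucleus of $G$. For a field $K$, the Nekrashevych algebra $\mathcal N_K(G,X)$ is the unital $*$-algebra over $K$ (with $K$-linear involution) generated by $X\cup G$ subject to the relations $g^*=g^{-1}$, $g\cdot h=gh$ for $g,h\in G$ (the identity of $G$ being the identity of the algebra), $gx=g(x)\,g|_x$ for $g\in G$, $x\in X$, $y^*x=\delta_{x,y}$ for $x,y\in X$, and $\sum_{x\in X}xx^*=1$. For an automaton $A\subseteq G$ define equivalence relations $\equiv_w$ on $A$, $w\in X^*$, as follows: $\equiv_\varepsilon$ is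 equality, and $g\equiv_{xw}h$ if and only if $g(x)=h(x)$ and $g|_x\equiv_w h|_x$. More generally, for $x\in X$ and an equivalence relation $\equiv$ on $A$, let $x\cdot{\equiv}$ be the relation that relates $g$ and $h$ when $g(x)=h(x)$ and $g|_x\equiv h|_x$; thus ${\equiv_{xw}}=x\cdot{\equiv_w}$. The simplicity graph $\Sigma_A$ is the finite directed graph whose vertex set is $V=\{\equiv_w : w\in X^*\}$ and which has an edge labeled $x$ from $\equiv$ to $x\cdot{\equiv}$ for each ${\equiv}\in V$ and $x\in X$. A vertex is essential if it is reachable by a directed path from a directed cycle; let $V_{\mathrm{ess}}$ be the set of essential vertices. The strongly connected components of $\Sigma_A$ are partially ordered by $\mathcal C\le\mathcal C'$ if there is a directed path from $\mathcal C'$ to $\mathcal C$; let $V_{\min}$ be the set of vertices contained in minimal components. For ${\equiv}\in V$, let $E_{\equiv,K}$ be the homogeneous system of linear equations over $K$ in variables $c_g$ ($g\in A$) consisting of the equations $\sum_{g\equiv h}c_g=0$, one for each $h\in A$, and let $E_{S,K}=\bigcup_{{\equiv}\in V_{\min}}E_{\equiv,K}$. One system is a consequence of another if each solution in $K$ of the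 latter is a solution of the former. Theorem. Let $G$ be a contracting self-similar group over $X$, let $K$ be a field, and let $A\subseteq G$ be an automaton containing the nucleus of $G$. Then $\mathcal N_K(G,X)$ is simple if and only if $E_{\equiv,K}$ is a consequence of $E_{S,K}$ for each ${\equiv}\in V_{\mathrm{ess}}\setminus V_{\min}$. -/

import Mathlib

/-- A self-similar group over the alphabet `X`: a faithful action of the group `G` on the set
`List X` of finite words over `X` by length-preserving permutations such that for every
`g : G` and every letter `x` there is a group element `h` (the section of `g` at `x`) with
`g (x w) = g(x) h(w)` for all words `w`. -/
structure SelfSimilarAction (G X : Type*) [Group G] where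
  /-- the permutation of the set of words given by a group element -/
  toPerm : G →* Equiv.Perm (List X)
  faithful : Function.Injective toPerm
  length_map : ∀ (g : G) (w : List X), (toPerm g w).length = w.length
  exists_section : ∀ (g : G) (x : X), ∃ h : G, ∀ w : List X,
    toPerm g (x :: w) = toPerm g [x] ++ toPerm h w

namespace SelfSimilarAction

variable {G X : Type*} [Group G] (S : SelfSimilarAction G X)

theorem map_singleton_ne_nil (g : G) (x : X) : S.toPerm g [x] ≠ [] := by
  intro h
  have := S.length_map g [x]
  simp [h] at this

/-- The letter `g(x)`: the unique letter of the word `g` applied to the one-letter word `x`. -/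
def letter (g : G) (x : X) : X := (S.toPerm g [x]).head (S.map_singleton_ne_nil g x)

/-- The section `g|_x` of `g` at the letter `x` (unique, since the action is faithful). -/
noncomputable def sec (g : G) (x : X) : G := Classical.choose (S.exists_section g x)

theorem map_cons (g : G) (x : X) (w : List X) :
    S.toPerm g (x :: w) = S.letter g x :: S.toPerm (S.sec g x) w := by
  have h1 : S.toPerm g (x :: w) = S.toPerm g [x] ++ S.toPerm (S.sec g x) w :=
    Classical.choose_spec (S.exists_section g x) w
  have h2 : S.toPerm g [x] = [S.letter g x] := by
    obtain ⟨a, ha⟩ := List.length_eq_one_iff.1 (S.length_map g [x])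
    simp [letter, ha]
  rw [h1, h2]
  rfl

theorem sec_eq_of_forall {g h : G} {x : X}
    (hh : ∀ w : List X, S.toPerm g (x :: w) = S.letter g x :: S.toPerm h w) :
    S.sec g x = h := by
  apply S.faithful
  ext1 w
  have := (S.map_cons g x w).symm.trans (hh w)
  simpa using this

/-- The section `g|_w` at a word, with `g|_{xv} = (g|_x)|_v`. -/
noncomputable def secWord (g : G) : List X → G
  | [] => g
  | x :: v => secWord (S.sec g x) v

theorem secWord_append (g : G) (u v : List X) :
    S.secWord g (u ++ v) = S.secWord (S.secWord g u) v := by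
  induction u generalizing g with
  | nil => rfl
  | cons x u ih => exact ih (S.sec g x)

/-- A set of group elements is closed under taking sections. -/
def SectionClosed (N : Set G) : Prop := ∀ g ∈ N, ∀ x : X, S.sec g x ∈ N

/-- `N` is a finite set of group elements, closed under taking sections, such that every
`g : G` has some level `n` at which all its sections lie in `N`. -/
def IsAttracting (N : Set G) : Prop :=
  N.Finite ∧ S.SectionClosed N ∧
    ∀ g : G, ∃ n : ℕ, ∀ w : List X, w.length = n → S.secWord g w ∈ N

/-- The self-similar group is contracting. -/
def IsContracting : Prop := ∃ N : Set G, S.IsAttracting N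

/-- The nucleus: the smallest attracting set (see `nucleus_isLeast`). -/
def nucleus : Set G := ⋂₀ {N : Set G | S.IsAttracting N}

theorem SectionClosed.secWord_mem {N : Set G} (hN : S.SectionClosed N) {g : G} (hg : g ∈ N)
    (w : List X) : S.secWord g w ∈ N := by
  induction w generalizing g with
  | nil => exact hg
  | cons x w ih => exact ih (hN g hg x)

theorem IsAttracting.inter {N N' : Set G} (h : S.IsAttracting N) (h' : S.IsAttracting N') :
    S.IsAttracting (N ∩ N') := by
  refine ⟨h.1.inter_of_left _, fun g hg x => ⟨h.2.1 g hg.1 x, h'.2.1 g hg.2 x⟩, fun g => ?_⟩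
  obtain ⟨n, hn⟩ := h.2.2 g
  obtain ⟨m, hm⟩ := h'.2.2 g
  refine ⟨n + m, fun w hw => ⟨?_, ?_⟩⟩
  · rw [← List.take_append_drop n w, secWord_append]
    exact h.2.1.secWord_mem S (hn _ (by simp [hw])) _
  · rw [← List.take_append_drop m w, secWord_append]
    exact h'.2.1.secWord_mem S (hm _ (by simp [hw])) _

/-- In a contracting group the nucleus is indeed the smallest attracting set. -/
theorem nucleus_isLeast (h : S.IsContracting) :
    IsLeast {N : Set G | S.IsAttracting N} S.nucleus := by
  classical
  have hex : ∃ k : ℕ, ∃ N : Set G, S.IsAttracting N ∧ N.ncard = k := by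
    obtain ⟨N, hN⟩ := h
    exact ⟨_, N, hN, rfl⟩
  obtain ⟨N, hN, hk⟩ := Nat.find_spec hex
  have hmin : ∀ N', S.IsAttracting N' → N ⊆ N' := by
    intro N' hN'
    have hle : N.ncard ≤ (N ∩ N').ncard := by
      rw [hk]
      exact Nat.find_min' hex ⟨_, hN.inter S hN', rfl⟩
    exact Set.inter_eq_left.1 (Set.eq_of_subset_of_ncard_le Set.inter_subset_left hle hN.1)
  have hNeq : S.nucleus = N :=
    Set.Subset.antisymm (Set.sInter_subset_of_mem hN) (Set.subset_sInter hmin)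
  rw [hNeq]
  exact ⟨hN, fun N' hN' => hmin N' hN'⟩

end SelfSimilarAction

/-- The generators of the Nekrashevych algebra as an algebra: the letters `x`, the group
elements `g`, and their formal adjoints. -/
inductive NekGen (G X : Type*)
  | letter (x : X)
  | letterStar (x : X)
  | elt (g : G)
  | eltStar (g : G)

namespace SelfSimilarAction

variable {G X : Type*} [Group G]

/-- The defining relations of the Nekrashevych algebra, in the free algebra on the letters and
group elements and their adjoints. The identity of the group is the identity of the algebra.
Up to `elt_star` the list is closed under the involution that exchanges every generator with
its adjoint and reverses products. -/
inductive NekRel (K : Type*) [Field K] [Fintype X] (S : SelfSimilarAction G X) :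
    FreeAlgebra K (NekGen G X) → FreeAlgebra K (NekGen G X) → Prop
  | elt_star (g : G) :
      NekRel K S (FreeAlgebra.ι K (.eltStar g)) (FreeAlgebra.ι K (.elt g⁻¹))
  | elt_mul (g h : G) :
      NekRel K S (FreeAlgebra.ι K (.elt g) * FreeAlgebra.ι K (.elt h))
        (FreeAlgebra.ι K (.elt (g * h)))
  | elt_one : NekRel K S (FreeAlgebra.ι K (.elt 1)) 1
  | ss (g : G) (x : X) :
      NekRel K S (FreeAlgebra.ι K (.elt g) * FreeAlgebra.ι K (.letter x))
        (FreeAlgebra.ι K (.letter (S.letter g x)) * FreeAlgebra.ι K (.elt (S.sec g x)))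
  | ss_star (g : G) (x : X) :
      NekRel K S (FreeAlgebra.ι K (.letterStar x) * FreeAlgebra.ι K (.eltStar g))
        (FreeAlgebra.ι K (.eltStar (S.sec g x)) * FreeAlgebra.ι K (.letterStar (S.letter g x)))
  | ck1_same (x : X) :
      NekRel K S (FreeAlgebra.ι K (.letterStar x) * FreeAlgebra.ι K (.letter x)) 1
  | ck1_ne (x y : X) (hxy : x ≠ y) :
      NekRel K S (FreeAlgebra.ι K (.letterStar y) * FreeAlgebra.ι K (.letter x)) 0
  | ck2 :
      NekRel K S (∑ x : X, FreeAlgebra.ι K (.letter x) * FreeAlgebra.ι K (.letterStar x)) 1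

/-- The Nekrashevych algebra of a self-similar group with coefficients in the field `K`. -/
def NekAlgebra (K : Type*) [Field K] [Fintype X] (S : SelfSimilarAction G X) : Type _ :=
  RingQuot (NekRel K S)

noncomputable instance (K : Type*) [Field K] [Fintype X] (S : SelfSimilarAction G X) :
    Ring (NekAlgebra K S) := inferInstanceAs (Ring (RingQuot (NekRel K S)))

noncomputable instance (K : Type*) [Field K] [Fintype X] (S : SelfSimilarAction G X) :
    Algebra K (NekAlgebra K S) := inferInstanceAs (Algebra K (RingQuot (NekRel K S)))

/-- A finite automaton in a self-similar group: a finite set of group elements, its states,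
closed under taking sections. -/
structure Automaton (S : SelfSimilarAction G X) where
  states : Finset G
  sectionClosed : S.SectionClosed (states : Set G)

namespace Automaton

variable {S : SelfSimilarAction G X} (A : Automaton S)

/-- The section of a state at a letter, as a state. -/
noncomputable def next (g : A.states) (x : X) : A.states :=
  ⟨S.sec g x, A.sectionClosed g g.2 x⟩

/-- The action of a letter on equivalence relations on the automaton:
`g` and `h` are related by `x · r` if `g(x) = h(x)` and `g|_x`, `h|_x` are related by `r`. -/
def dot (x : X) (r : Setoid A.states) : Setoid A.states where
  r g h := S.letter g x = S.letter h x ∧ r (A.next g x) (A.next h x)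
  iseqv :=
    ⟨fun _ => ⟨rfl, r.refl _⟩, fun h => ⟨h.1.symm, r.symm h.2⟩,
      fun h h' => ⟨h.1.trans h'.1, r.trans h.2 h'.2⟩⟩

/-- The relation `≡_w` : for the empty word it is equality, and `≡_{xw} = x · ≡_w`. -/
def eqv : List X → Setoid A.states
  | [] => ⊥
  | x :: w => A.dot x (eqv w)

/-- The vertices of the simplicity graph: the equivalence relations `≡_w`. -/
@[ext]
structure Vertex where
  rel : Setoid A.states
  exists_word : ∃ w : List X, rel = A.eqv w

/-- There is an edge of the simplicity graph from `v` to `v'`: for some letter `x`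
(the label of the edge), `v' = x · v`. -/
def Edge (v v' : A.Vertex) : Prop := ∃ x : X, v'.rel = A.dot x v.rel

/-- There is a directed path (possibly of length zero) from `v` to `v'`. -/
def Reaches (v v' : A.Vertex) : Prop := Relation.ReflTransGen A.Edge v v'

/-- The reachability preorder: `v ≤ v'` if there is a directed path from `v'` to `v`. -/
instance : Preorder A.Vertex where
  le v v' := A.Reaches v' v
  le_refl _ := Relation.ReflTransGen.refl
  le_trans _ _ _ h h' := Relation.ReflTransGen.trans h' h

/-- The strongly connected components of the simplicity graph (classes of mutually reachable
vertices), partially ordered by reachability. -/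
abbrev Component : Type _ := Antisymmetrization A.Vertex (· ≤ ·)

/-- The strongly connected component of a vertex. -/
def component (v : A.Vertex) : A.Component := toAntisymmetrization (· ≤ ·) v

/-- The set of vertices that belong to minimal strongly connected components. -/
def Vmin : Set A.Vertex := {v | IsMin (A.component v)}

/-- The set of essential vertices: those reachable from a directed cycle. -/
def Vess : Set A.Vertex := {v | ∃ u : A.Vertex, Relation.TransGen A.Edge u u ∧ A.Reaches u v}

open Classical in
/-- The homogeneous system of linear equations `∑_{g ≡ h} c_g = 0`, one for each state `h`,
over the integers in the variables `c_g`; an equation is given by its coefficient vector. -/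
noncomputable def system (r : Setoid A.states) : Set (A.states → ℤ) :=
  {f | ∃ h : A.states, f = fun g => if r g h then 1 else 0}

/-- The union of the systems of all vertices in minimal strongly connected components. -/
noncomputable def systemS : Set (A.states → ℤ) := ⋃ v ∈ A.Vmin, A.system v.rel

end Automaton

end SelfSimilarAction

/-- `c` solves, over the field `K`, the homogeneous system `E` of integer linear equations. -/
def IsSolution {ι : Type*} [Fintype ι] {K : Type*} [Field K] (E : Set (ι → ℤ)) (c : ι → K) :
    Prop :=
  ∀ f ∈ E, ∑ i, (f i : K) * c i = 0

/-- The system `E'` is a consequence of the system `E` over `K`: every solution of `E` with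
values in `K` is a solution of `E'`. -/
def IsConsequence {ι : Type*} [Fintype ι] (K : Type*) [Field K] (E' E : Set (ι → ℤ)) : Prop :=
  ∀ c : ι → K, IsSolution E c → IsSolution E' c

/-!
The letters and the group elements span in the Nekrashevych algebra the image of the monoid algebra
of the Zappa–Szép product `X* ⋈ G`. Letting the generators act on that monoid algebra by left
multiplications and, for the adjoints, by left divisions respects all relations up to the behaviour
on short words. Hence a combination `f` of elements `u g` vanishes in the Nekrashevych algebra if
and only if `f w = 0` in the monoid algebra for all long words `w`; and the equations `f w = 0` for
`f = ∑ c_g g` are exactly the system attached to the vertex `≡_w`.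

Call `b` singular if every word `p` can be prolonged to a word `p s` with `b p s = 0`. The singular
elements form a proper ideal, and it is the largest one: if `b` in an ideal `I` is not singular,
then among the combinations of elements `u g` with values in `I` that no word annihilates, take one
with smallest support. Divisions by words do not enlarge supports, which forces any two elements of
the support to stay comparable after multiplication with an arbitrary word, so that they coincide.
The only remaining element is left invertible, so `I` contains `1`.

Thus the algebra is simple if and only if it has no non-zero singular element. Contraction reduces
this to combinations with coefficients on the states of the automaton. Such a combination vanishes
if and only if it solves the systems of the essential vertices, because these are the `≡_w` for
arbitrarily long `w`, and it is singular if and only if it solves the systems of the vertices in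
minimal components, because these are the vertices to which one can always return.
-/

section LeftDivision

open scoped MonoidAlgebra

variable {M K : Type*} [Monoid M] [IsLeftCancelMul M] [Semiring K]

/-- Left division by a monoid element `m`: the linear map `K[M] → K[M]` that sends `m * n` to `n`
and annihilates the elements of `M` that are not left multiples of `m`. It is the adjoint of left
multiplication by `m`. -/
noncomputable def leftDiv (m : M) : K[M] →ₗ[K] K[M] where
  toFun f := .ofCoeff (f.coeff.comapDomain (m * ·) (mul_right_injective m).injOn)
  map_add' f g := by ext; simp
  map_smul' c f := by ext; simp

@[simp] theorem coeff_leftDiv (m n : M) (f : K[M]) : (leftDiv m f).coeff n = f.coeff (m * n) := rfl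

theorem leftDiv_mul (m n : M) (f : K[M]) : leftDiv (m * n) f = leftDiv n (leftDiv m f) := by
  ext; simp [mul_assoc]

theorem leftDiv_one (f : K[M]) : leftDiv 1 f = f := by
  ext; simp

theorem coeff_of_mul_mul (m n : M) (f : K[M]) : (.of K M m * f).coeff (m * n) = f.coeff n := by
  rw [MonoidAlgebra.of_apply, MonoidAlgebra.coeff_single_mul_eq_mul_coeff n (by simp), one_mul]

theorem leftDiv_of_mul (m : M) (f : K[M]) : leftDiv m (.of K M m * f) = f := by
  ext n
  exact coeff_of_mul_mul m n f

theorem leftDiv_of_mul_eq_one {m n : M} (h : m * n = 1) (f : K[M]) :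
    leftDiv m f = .of K M n * f := by
  calc leftDiv m f = leftDiv m (.of K M m * (.of K M n * f)) := by
        rw [← mul_assoc, ← map_mul, h, map_one, one_mul]
    _ = .of K M n * f := by rw [leftDiv_of_mul]

theorem leftDiv_of_mul_eq_zero {m n : M} (h : ∀ a b, m * a ≠ n * b) (f : K[M]) :
    leftDiv m (.of K M n * f) = 0 := by
  ext a
  simp [fun b => (h a b).symm]

theorem card_support_leftDiv_le (m : M) (f : K[M]) :
    (leftDiv m f).coeff.support.card ≤ f.coeff.support.card :=
  Finset.card_le_card_of_injOn (m * ·) (fun n hn => by simpa using hn)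
    (mul_right_injective m).injOn

theorem exists_eq_mul_of_card_support_leftDiv {m : M} {f : K[M]}
    (h : f.coeff.support.card ≤ (leftDiv m f).coeff.support.card) {n : M}
    (hn : n ∈ f.coeff.support) : ∃ a, n = m * a := by
  classical
  have himage : (leftDiv m f).coeff.support.image (m * ·) = f.coeff.support :=
    Finset.eq_of_subset_of_card_le (Finset.image_subset_iff.2 fun a ha => by simpa using ha)
      (by rwa [Finset.card_image_of_injective _ (mul_right_injective m)])
  rw [← himage] at hn
  obtain ⟨a, -, rfl⟩ := Finset.mem_image.1 hn
  exact ⟨a, rfl⟩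

end LeftDivision

section RightMultiplication

open scoped MonoidAlgebra

variable {M K : Type*} [Monoid M] [Semiring K]

theorem card_support_mul_of_le (f : K[M]) (m : M) :
    (f * .of K M m).coeff.support.card ≤ f.coeff.support.card := by
  classical
  exact (Finset.card_le_card (MonoidAlgebra.support_coeff_mul_single_subset f 1 m)).trans
    Finset.card_image_le

theorem mul_mem_support_mul_of {f : K[M]} {m : M}
    (h : f.coeff.support.card ≤ (f * .of K M m).coeff.support.card) {n : M}
    (hn : n ∈ f.coeff.support) : n * m ∈ (f * .of K M m).coeff.support := by
  classical
  have himage := Finset.eq_of_subset_of_card_le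
    (MonoidAlgebra.support_coeff_mul_single_subset f 1 m) (Finset.card_image_le.trans h)
  exact himage ▸ Finset.mem_image_of_mem _ hn

theorem coeff_mul_of (f : K[M]) (m n : M) [DecidableEq M] :
    (f * .of K M m).coeff n = ∑ a ∈ f.coeff.support with a * m = n, f.coeff a := by
  simp [MonoidAlgebra.coeff_mul, Finset.sum_filter]
  rfl

end RightMultiplication

namespace SelfSimilarAction

variable {G X : Type*} [Group G] (S : SelfSimilarAction G X)

theorem toPerm_nil (g : G) : S.toPerm g [] = [] :=
  List.length_eq_zero_iff.1 (S.length_map g [])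

theorem toPerm_singleton (g : G) (x : X) : S.toPerm g [x] = [S.letter g x] := by
  rw [map_cons, toPerm_nil]

theorem toPerm_append (g : G) (u v : List X) :
    S.toPerm g (u ++ v) = S.toPerm g u ++ S.toPerm (S.secWord g u) v := by
  induction u generalizing g with
  | nil => simp [toPerm_nil, secWord]
  | cons x u ih => simp [map_cons, ih, secWord]

theorem letter_injective (g : G) : Function.Injective (S.letter g) := by
  intro x y h
  have : S.toPerm g [x] = S.toPerm g [y] := by rw [toPerm_singleton, toPerm_singleton, h]
  simpa using (S.toPerm g).injective this

theorem secWord_eq_of_forall {g h : G} {u : List X}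
    (hh : ∀ v, S.toPerm g (u ++ v) = S.toPerm g u ++ S.toPerm h v) : S.secWord g u = h := by
  apply S.faithful
  ext1 v
  simpa [toPerm_append] using hh v

theorem secWord_one (u : List X) : S.secWord 1 u = 1 :=
  S.secWord_eq_of_forall (by simp)

theorem secWord_mul (g h : G) (u : List X) :
    S.secWord (g * h) u = S.secWord g (S.toPerm h u) * S.secWord h u :=
  S.secWord_eq_of_forall fun v => by simp [toPerm_append]

theorem exists_forall_secWord_mem {N : Set G} (hN : S.IsAttracting N) (B : Finset G) :
    ∃ n : ℕ, ∀ g ∈ B, ∀ w : List X, n ≤ w.length → S.secWord g w ∈ N := by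
  choose n hn using hN.2.2
  refine ⟨B.sup n, fun g hg w hw => ?_⟩
  rw [← List.take_append_drop (n g) w, secWord_append]
  exact hN.2.1.secWord_mem S (hn g _ (by simpa using (Finset.le_sup hg).trans hw)) _

/-- The Zappa–Szép product of the free monoid on `X` and the group `G`: its elements are the
formal products `u g` of a word `u` and a group element `g`, multiplied according to the rule
`g v = g(v) g|_v`. -/
@[ext]
structure ZappaSzep (S : SelfSimilarAction G X) where
  word : List X
  elt : G

namespace ZappaSzep

variable {S}

noncomputable instance : Monoid S.ZappaSzep where
  mul m n := ⟨m.word ++ S.toPerm m.elt n.word, S.secWord m.elt n.word * n.elt⟩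
  one := ⟨[], 1⟩
  mul_assoc l m n := by
    ext1
    · change (_ ++ _) ++ S.toPerm (_ * _) _ = _ ++ S.toPerm _ (_ ++ _)
      simp [toPerm_append]
    · change S.secWord (_ * _) _ * _ = S.secWord _ (_ ++ _) * (_ * _)
      simp [secWord_append, secWord_mul, mul_assoc]
  one_mul m := by
    ext1
    · change [] ++ S.toPerm 1 _ = _
      simp
    · change S.secWord 1 _ * _ = _
      rw [secWord_one, one_mul]
  mul_one m := by
    ext1
    · change _ ++ S.toPerm _ [] = _
      rw [toPerm_nil, List.append_nil]
    · exact mul_one _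

@[simp] theorem word_one : (1 : S.ZappaSzep).word = [] := rfl

@[simp] theorem elt_one : (1 : S.ZappaSzep).elt = 1 := rfl

@[simp] theorem word_mul (m n : S.ZappaSzep) : (m * n).word = m.word ++ S.toPerm m.elt n.word := rfl

@[simp] theorem elt_mul (m n : S.ZappaSzep) : (m * n).elt = S.secWord m.elt n.word * n.elt := rfl

theorem length_word_mul (m n : S.ZappaSzep) :
    (m * n).word.length = m.word.length + n.word.length := by
  simp [S.length_map]

instance : IsLeftCancelMul S.ZappaSzep where
  mul_left_cancel l m n h := by
    have hword : m.word = n.word := by simpa using congrArg word h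
    have helt : m.elt = n.elt := by simpa [hword] using congrArg elt h
    exact ZappaSzep.ext hword helt

variable (S) in
/-- A word, as an element of the Zappa–Szép product. -/
def ofWord (w : List X) : S.ZappaSzep := ⟨w, 1⟩

variable (S) in
/-- A group element, as an element of the Zappa–Szép product. -/
def ofElt (g : G) : S.ZappaSzep := ⟨[], g⟩

@[simp] theorem word_ofWord (w : List X) : (ofWord S w).word = w := rfl

@[simp] theorem elt_ofWord (w : List X) : (ofWord S w).elt = 1 := rfl

@[simp] theorem word_ofElt (g : G) : (ofElt S g).word = [] := rfl

@[simp] theorem elt_ofElt (g : G) : (ofElt S g).elt = g := rfl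

theorem ofWord_nil : ofWord S [] = 1 := rfl

theorem ofWord_append (u v : List X) : ofWord S (u ++ v) = ofWord S u * ofWord S v := by
  ext1 <;> simp [secWord_one]

theorem ofWord_cons (x : X) (w : List X) : ofWord S (x :: w) = ofWord S [x] * ofWord S w :=
  ofWord_append [x] w

theorem ofElt_one : ofElt S 1 = 1 := rfl

theorem ofElt_mul (g h : G) : ofElt S (g * h) = ofElt S g * ofElt S h := by
  ext1 <;> simp [toPerm_nil, secWord]

theorem ofWord_mul_ofElt (m : S.ZappaSzep) : ofWord S m.word * ofElt S m.elt = m := by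
  ext1 <;> simp [secWord]

theorem ofElt_mul_ofWord_singleton (g : G) (x : X) :
    ofElt S g * ofWord S [x] = ofWord S [S.letter g x] * ofElt S (S.sec g x) := by
  ext1 <;> simp [toPerm_singleton, secWord]

theorem mul_ofWord (m : S.ZappaSzep) (w : List X) :
    m * ofWord S w =
      ofWord S m.word * ofWord S (S.toPerm m.elt w) * ofElt S (S.secWord m.elt w) := by
  rw [← ofWord_append]
  ext1 <;> simp [secWord]

theorem mul_ofWord_eq_mul_ofWord_iff {m n : S.ZappaSzep} {w : List X} :
    m * ofWord S w = n * ofWord S w ↔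
      m.word = n.word ∧ ofElt S m.elt * ofWord S w = ofElt S n.elt * ofWord S w := by
  constructor
  · intro h
    obtain ⟨hword, hperm⟩ := List.append_inj' (congrArg word h) (by simp [S.length_map])
    exact ⟨hword, ZappaSzep.ext (by simpa using hperm) (by simpa using congrArg elt h)⟩
  · rintro ⟨hword, hstate⟩
    rw [← ofWord_mul_ofElt m, ← ofWord_mul_ofElt n, mul_assoc, mul_assoc, hword, hstate]

theorem exists_eq_ofWord_mul_iff {q : List X} {m : S.ZappaSzep} :
    (∃ a, m = ofWord S q * a) ↔ q <+: m.word := by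
  constructor
  · rintro ⟨a, rfl⟩
    simp
  · rintro ⟨v, hv⟩
    exact ⟨⟨v, m.elt⟩, by ext1 <;> simp [hv, secWord_one]⟩

theorem ofWord_singleton_mul_ne {x y : X} (hxy : x ≠ y) (m n : S.ZappaSzep) :
    ofWord S [x] * m ≠ ofWord S [y] * n :=
  fun h => hxy (by simpa using congrArg (·.word.head?) h)

theorem exists_not_prefix_mul_ofWord [Nontrivial X] {m n : S.ZappaSzep} (hmn : m ≠ n) :
    ∃ s : List X, ¬ (m * ofWord S s).word <+: (n * ofWord S s).word := by
  by_contra! hprefix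
  obtain ⟨t, ht⟩ := by simpa [toPerm_nil] using hprefix []
  rcases t with - | ⟨y, t⟩
  · have hword : m.word = n.word := by simpa using ht
    refine hmn (ZappaSzep.ext hword (S.faithful (Equiv.ext fun s => ?_)))
    have hs : S.toPerm m.elt s <+: S.toPerm n.elt s := by simpa [hword] using hprefix s
    exact hs.eq_of_length (by simp only [S.length_map])
  · have hletter : ∀ z, S.letter m.elt z = y := fun z => by
      have := hprefix [z]
      simp only [word_mul, word_ofWord, ← ht, List.append_assoc, List.prefix_append_right_inj,
        toPerm_singleton] at this
      simpa using this
    obtain ⟨z, z', hz⟩ := exists_pair_ne X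
    exact hz (S.letter_injective m.elt ((hletter z).trans (hletter z').symm))

end ZappaSzep

end SelfSimilarAction

namespace SelfSimilarAction

open scoped MonoidAlgebra
open ZappaSzep

variable {G X : Type*} [Group G]

section LengthFiltration

variable (K : Type*) [Semiring K] (S : SelfSimilarAction G X)

/-- The span of the elements `u g` of the Zappa–Szép product whose word `u` has length at least
`n`. -/
noncomputable def lengthGe (n : ℕ) : Submodule K K[S.ZappaSzep] :=
  MonoidAlgebra.supported K K {m | n ≤ m.word.length}

variable {K S}

theorem mem_lengthGe {n : ℕ} {f : K[S.ZappaSzep]} :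
    f ∈ lengthGe K S n ↔ ∀ m ∈ f.coeff.support, n ≤ m.word.length :=
  Iff.rfl

theorem lengthGe_antitone : Antitone (lengthGe K S) :=
  fun _ _ h _ hf _ hm => h.trans (hf hm)

theorem of_mem_lengthGe (m : S.ZappaSzep) : .of K _ m ∈ lengthGe K S m.word.length := by
  classical
  intro n hn
  obtain rfl : n = m := by simpa using Finsupp.support_single_subset hn
  exact le_refl n.word.length

theorem mul_mem_lengthGe_right (f : K[S.ZappaSzep]) {g : K[S.ZappaSzep]} {n : ℕ}
    (hg : g ∈ lengthGe K S n) : f * g ∈ lengthGe K S n := by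
  classical
  intro m hm
  obtain ⟨a, -, b, hb, rfl⟩ := Finset.mem_mul.1 (MonoidAlgebra.support_coeff_mul_subset f g hm)
  exact (hg hb).trans (length_word_mul a b ▸ Nat.le_add_left _ _)

theorem leftDiv_mem_lengthGe {m : S.ZappaSzep} {f : K[S.ZappaSzep]} {n : ℕ}
    (hf : f ∈ lengthGe K S (n + m.word.length)) : leftDiv m f ∈ lengthGe K S n := by
  intro a ha
  have hle := mem_lengthGe.1 hf (m * a) (by simpa using ha)
  rw [length_word_mul, add_comm] at hle
  exact Nat.le_of_add_le_add_left hle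

theorem sum_letter_mul_leftDiv [Fintype X] {f : K[S.ZappaSzep]} (hf : f ∈ lengthGe K S 1) :
    ∑ x : X, .of K _ (ofWord S [x]) * leftDiv (ofWord S [x]) f = f := by
  ext m
  simp only [MonoidAlgebra.coeff_sum, Finsupp.finsetSum_apply]
  by_cases hm : ∃ y a, m = ofWord S [y] * a
  · obtain ⟨y, a, rfl⟩ := hm
    rw [Finset.sum_eq_single_of_mem y (Finset.mem_univ y), coeff_of_mul_mul, coeff_leftDiv]
    exact fun x _ hxy => MonoidAlgebra.coeff_single_mul_of_forall_mul_ne _ _ fun d =>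
      ofWord_singleton_mul_ne hxy d a
  · have hword : m.word = [] := by
      rcases hm' : m.word with - | ⟨y, v⟩
      · rfl
      · exact absurd ⟨y, exists_eq_ofWord_mul_iff.2 (hm' ▸ List.prefix_append [y] v)⟩ hm
    have hcoeff : f.coeff m = 0 := by
      by_contra hne
      simpa [hword] using mem_lengthGe.1 hf m (Finsupp.mem_support_iff.2 hne)
    rw [hcoeff]
    exact Finset.sum_eq_zero fun x _ => MonoidAlgebra.coeff_single_mul_of_forall_mul_ne _ _
      fun d h => hm ⟨x, d, h.symm⟩

end LengthFiltration

section Fock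

variable (K : Type*) [CommSemiring K] (S : SelfSimilarAction G X)

/-- The operators on the monoid algebra of the Zappa–Szép product by which the generators of the
Nekrashevych algebra act: left multiplications and, for the adjoints, left divisions. -/
noncomputable def fockGen : NekGen G X → Module.End K K[S.ZappaSzep]
  | .letter x => LinearMap.mulLeft K (.of K _ (ofWord S [x]))
  | .letterStar x => leftDiv (ofWord S [x])
  | .elt g => LinearMap.mulLeft K (.of K _ (ofElt S g))
  | .eltStar g => leftDiv (ofElt S g)

/-- The Fock representation of the free algebra on the generators of the Nekrashevych algebra. It
respects all defining relations except `∑ x x* = 1`, which holds on combinations of elements `u g`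
with non-empty `u`. -/
noncomputable def fock : FreeAlgebra K (NekGen G X) →ₐ[K] Module.End K K[S.ZappaSzep] :=
  FreeAlgebra.lift K (fockGen K S)

variable {K S}

theorem fock_letter (x : X) (f : K[S.ZappaSzep]) :
    fock K S (FreeAlgebra.ι K (.letter x)) f = .of K _ (ofWord S [x]) * f := by
  simp [fock, fockGen]

theorem fock_letterStar (x : X) (f : K[S.ZappaSzep]) :
    fock K S (FreeAlgebra.ι K (.letterStar x)) f = leftDiv (ofWord S [x]) f := by
  simp [fock, fockGen]

theorem fock_elt (g : G) (f : K[S.ZappaSzep]) :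
    fock K S (FreeAlgebra.ι K (.elt g)) f = .of K _ (ofElt S g) * f := by
  simp [fock, fockGen]

theorem fock_eltStar (g : G) (f : K[S.ZappaSzep]) :
    fock K S (FreeAlgebra.ι K (.eltStar g)) f = leftDiv (ofElt S g) f := by
  simp [fock, fockGen]

theorem exists_forall_fock_mem_lengthGe (a : FreeAlgebra K (NekGen G X)) :
    ∃ k, ∀ n, ∀ f ∈ lengthGe K S (n + k), fock K S a f ∈ lengthGe K S n := by
  induction a using FreeAlgebra.induction with
  | grade0 c =>
    refine ⟨0, fun n f hf => ?_⟩
    rw [AlgHom.commutes, Module.algebraMap_end_apply]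
    exact Submodule.smul_mem _ c hf
  | grade1 y =>
    refine ⟨1, fun n f hf => ?_⟩
    have hf' := lengthGe_antitone (Nat.le_succ n) hf
    cases y with
    | letter x => rw [fock_letter]; exact mul_mem_lengthGe_right _ hf'
    | letterStar x => rw [fock_letterStar]; exact leftDiv_mem_lengthGe hf
    | elt g => rw [fock_elt]; exact mul_mem_lengthGe_right _ hf'
    | eltStar g => rw [fock_eltStar]; exact leftDiv_mem_lengthGe hf'
  | mul a b ha hb =>
    obtain ⟨k, hk⟩ := ha
    obtain ⟨l, hl⟩ := hb
    refine ⟨k + l, fun n f hf => ?_⟩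
    rw [map_mul]
    exact hk n _ (hl (n + k) f (by rwa [add_assoc]))
  | add a b ha hb =>
    obtain ⟨k, hk⟩ := ha
    obtain ⟨l, hl⟩ := hb
    refine ⟨k + l, fun n f hf => ?_⟩
    rw [map_add]
    exact Submodule.add_mem _ (hk n f (lengthGe_antitone (by omega) hf))
      (hl n f (lengthGe_antitone (by omega) hf))

variable (K S) in
/-- Two elements of the free algebra are related if they act in the same way, in the Fock
representation, on all combinations of elements `u g` with `u` long enough. -/
def fockCon : RingCon (FreeAlgebra K (NekGen G X)) where
  r a b := ∃ k, ∀ f ∈ lengthGe K S k, fock K S a f = fock K S b f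
  iseqv :=
    { refl := fun _ => ⟨0, fun _ _ => rfl⟩
      symm := fun ⟨k, hk⟩ => ⟨k, fun f hf => (hk f hf).symm⟩
      trans := fun ⟨k, hk⟩ ⟨l, hl⟩ => ⟨k + l, fun f hf =>
        (hk f (lengthGe_antitone (by omega) hf)).trans
          (hl f (lengthGe_antitone (by omega) hf))⟩ }
  add' := fun ⟨k, hk⟩ ⟨l, hl⟩ => ⟨k + l, fun f hf => by
    rw [map_add, map_add, LinearMap.add_apply, LinearMap.add_apply,
      hk f (lengthGe_antitone (by omega) hf), hl f (lengthGe_antitone (by omega) hf)]⟩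
  mul' := by
    rintro a b c d ⟨k, hk⟩ ⟨l, hl⟩
    obtain ⟨j, hj⟩ := exists_forall_fock_mem_lengthGe (S := S) c
    refine ⟨k + j + l, fun f hf => ?_⟩
    rw [map_mul, map_mul, Module.End.mul_apply, Module.End.mul_apply,
      hk _ (hj k f (lengthGe_antitone (by omega) hf)), hl f (lengthGe_antitone (by omega) hf)]

end Fock

theorem fockCon_of_nekRel [Fintype X] {K : Type*} [Field K] {S : SelfSimilarAction G X}
    {a b : FreeAlgebra K (NekGen G X)} (h : NekRel K S a b) : fockCon K S a b := by
  suffices hrel : ∀ f ∈ lengthGe K S 1, fock K S a f = fock K S b f from ⟨1, hrel⟩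
  intro f hf
  cases h with
  | elt_star g =>
    rw [fock_eltStar, fock_elt, leftDiv_of_mul_eq_one]
    rw [← ofElt_mul, mul_inv_cancel, ofElt_one]
  | elt_mul g h =>
    rw [map_mul, Module.End.mul_apply, fock_elt, fock_elt, fock_elt, ← mul_assoc, ← map_mul,
      ofElt_mul]
  | elt_one => rw [fock_elt, ofElt_one, map_one, map_one, one_mul, Module.End.one_apply]
  | ss g x =>
    simp only [map_mul, Module.End.mul_apply, fock_elt, fock_letter, ← mul_assoc]
    rw [← map_mul, ofElt_mul_ofWord_singleton, map_mul]
  | ss_star g x =>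
    simp only [map_mul, Module.End.mul_apply, fock_eltStar, fock_letterStar, ← leftDiv_mul]
    rw [ofElt_mul_ofWord_singleton]
  | ck1_same x =>
    rw [map_mul, Module.End.mul_apply, fock_letter, fock_letterStar, leftDiv_of_mul, map_one,
      Module.End.one_apply]
  | ck1_ne x y hxy =>
    rw [map_mul, Module.End.mul_apply, fock_letter, fock_letterStar,
      leftDiv_of_mul_eq_zero (ofWord_singleton_mul_ne hxy.symm), map_zero, LinearMap.zero_apply]
  | ck2 =>
    simp only [map_sum, map_mul, LinearMap.sum_apply, Module.End.mul_apply, fock_letter,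
      fock_letterStar, map_one, Module.End.one_apply]
    exact sum_letter_mul_leftDiv hf

namespace NekAlgebra

variable [Fintype X] (K : Type*) [Field K] (S : SelfSimilarAction G X)

/-- The quotient map from the free algebra to the Nekrashevych algebra. -/
noncomputable def mk : FreeAlgebra K (NekGen G X) →ₐ[K] NekAlgebra K S :=
  RingQuot.mkAlgHom K (NekRel K S)

theorem mk_surjective : Function.Surjective (mk K S) :=
  RingQuot.mkAlgHom_surjective K (NekRel K S)

theorem mk_eq_mk {a b : FreeAlgebra K (NekGen G X)} (h : NekRel K S a b) : mk K S a = mk K S b :=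
  RingQuot.mkAlgHom_rel K h

/-- A letter, as an element of the Nekrashevych algebra. -/
noncomputable def letter (x : X) : NekAlgebra K S := mk K S (FreeAlgebra.ι K (.letter x))

/-- The adjoint of a letter, as an element of the Nekrashevych algebra. -/
noncomputable def letterStar (x : X) : NekAlgebra K S := mk K S (FreeAlgebra.ι K (.letterStar x))

/-- A group element, as an element of the Nekrashevych algebra. -/
noncomputable def elt (g : G) : NekAlgebra K S := mk K S (FreeAlgebra.ι K (.elt g))

theorem elt_mul (g h : G) : elt K S (g * h) = elt K S g * elt K S h := by
  simp only [elt, ← map_mul]; exact (mk_eq_mk K S (.elt_mul g h)).symm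

theorem elt_one : elt K S 1 = 1 := by
  rw [← map_one (mk K S)]; exact mk_eq_mk K S .elt_one

theorem mk_eltStar (g : G) : mk K S (FreeAlgebra.ι K (.eltStar g)) = elt K S g⁻¹ :=
  mk_eq_mk K S (.elt_star g)

theorem elt_mul_letter (g : G) (x : X) :
    elt K S g * letter K S x = letter K S (S.letter g x) * elt K S (S.sec g x) := by
  simp only [elt, letter, ← map_mul]; exact mk_eq_mk K S (.ss g x)

theorem letterStar_mul_letter_self (x : X) : letterStar K S x * letter K S x = 1 := by
  rw [letterStar, letter, ← map_mul, ← map_one (mk K S)]; exact mk_eq_mk K S (.ck1_same x)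

theorem letterStar_mul_letter_of_ne {x y : X} (h : x ≠ y) :
    letterStar K S y * letter K S x = 0 := by
  rw [letterStar, letter, ← map_mul, ← map_zero (mk K S)]; exact mk_eq_mk K S (.ck1_ne x y h)

theorem sum_letter_mul_letterStar : ∑ x : X, letter K S x * letterStar K S x = 1 := by
  simp only [letterStar, letter, ← map_mul, ← map_sum]
  rw [← map_one (mk K S)]; exact mk_eq_mk K S .ck2

/-- The product of the letters of a word. -/
noncomputable def word (w : List X) : NekAlgebra K S := (w.map (letter K S)).prod

/-- The adjoint of the product of the letters of a word. -/
noncomputable def wordStar (w : List X) : NekAlgebra K S := (w.reverse.map (letterStar K S)).prod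

theorem word_nil : word K S [] = 1 := rfl

theorem word_cons (x : X) (w : List X) : word K S (x :: w) = letter K S x * word K S w := by
  simp [word]

theorem word_append (u v : List X) : word K S (u ++ v) = word K S u * word K S v := by
  simp [word]

theorem wordStar_nil : wordStar K S [] = 1 := rfl

theorem wordStar_cons (x : X) (w : List X) :
    wordStar K S (x :: w) = wordStar K S w * letterStar K S x := by
  simp [wordStar]

theorem wordStar_mul_word_self (w : List X) : wordStar K S w * word K S w = 1 := by
  induction w with
  | nil => rw [wordStar_nil, word_nil, one_mul]
  | cons x w ih =>
    rw [wordStar_cons, word_cons, mul_assoc, ← mul_assoc (letterStar K S x),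
      letterStar_mul_letter_self, one_mul, ih]

theorem elt_mul_word (g : G) (w : List X) :
    elt K S g * word K S w = word K S (S.toPerm g w) * elt K S (S.secWord g w) := by
  induction w generalizing g with
  | nil => simp [word_nil, toPerm_nil, secWord]
  | cons x w ih =>
    rw [word_cons, ← mul_assoc, elt_mul_letter, mul_assoc, ih, map_cons, word_cons, mul_assoc]
    rfl

/-- The map of the Zappa–Szép product into the Nekrashevych algebra that sends `u g` to `u g`. -/
noncomputable def ofZappaSzep : S.ZappaSzep →* NekAlgebra K S where
  toFun m := word K S m.word * elt K S m.elt
  map_one' := by simp [word_nil, elt_one]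
  map_mul' m n := by
    simp only [word_mul, ZappaSzep.elt_mul, word_append, elt_mul, mul_assoc]
    rw [← mul_assoc (elt K S m.elt), elt_mul_word, mul_assoc]

/-- The homomorphism onto the subalgebra of the Nekrashevych algebra generated by the letters and
the group elements. -/
noncomputable def eval : K[S.ZappaSzep] →ₐ[K] NekAlgebra K S :=
  MonoidAlgebra.lift K _ _ (ofZappaSzep K S)

variable {K S}

theorem eval_of_ofWord (w : List X) : eval K S (.of K _ (ofWord S w)) = word K S w := by
  simp [eval, ofZappaSzep, elt_one]

theorem eval_of_ofElt (g : G) : eval K S (.of K _ (ofElt S g)) = elt K S g := by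
  simp [eval, ofZappaSzep, word_nil]

theorem eval_of_ofWord_singleton (x : X) :
    eval K S (.of K _ (ofWord S [x])) = letter K S x := by
  rw [eval_of_ofWord, word_cons, word_nil, mul_one]

theorem eq_zero_of_mul_word (n : ℕ) {b : NekAlgebra K S}
    (h : ∀ w : List X, w.length = n → b * word K S w = 0) : b = 0 := by
  induction n generalizing b with
  | zero => simpa [word_nil] using h [] rfl
  | succ n ih =>
    have hletter : ∀ x, b * letter K S x = 0 := fun x => ih fun w hw => by
      rw [mul_assoc, ← word_cons]
      exact h _ (by simp [hw])
    rw [← mul_one b, ← sum_letter_mul_letterStar, Finset.mul_sum]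
    exact Finset.sum_eq_zero fun x _ => by rw [← mul_assoc, hletter, zero_mul]

theorem eval_leftDiv_letter (x : X) {f : K[S.ZappaSzep]} (hf : f ∈ lengthGe K S 1) :
    eval K S (leftDiv (ofWord S [x]) f) = letterStar K S x * eval K S f := by
  conv_rhs => rw [← sum_letter_mul_leftDiv hf, map_sum, Finset.mul_sum]
  simp only [map_mul, eval_of_ofWord_singleton, ← mul_assoc]
  rw [Finset.sum_eq_single_of_mem x (Finset.mem_univ x), letterStar_mul_letter_self, one_mul]
  exact fun y _ hyx => by rw [letterStar_mul_letter_of_ne K S hyx, zero_mul]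

theorem eval_leftDiv_ofWord (q : List X) {f : K[S.ZappaSzep]} (hf : f ∈ lengthGe K S q.length) :
    eval K S (leftDiv (ofWord S q) f) = wordStar K S q * eval K S f := by
  induction q generalizing f with
  | nil => rw [ofWord_nil, leftDiv_one, wordStar_nil, one_mul]
  | cons x q ih =>
    have hf' : f ∈ lengthGe K S 1 := lengthGe_antitone (by simp) hf
    have hdiv : leftDiv (ofWord S [x]) f ∈ lengthGe K S q.length :=
      leftDiv_mem_lengthGe (by simpa using hf)
    rw [ofWord_cons, leftDiv_mul, ih hdiv, eval_leftDiv_letter x hf', wordStar_cons, mul_assoc]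

theorem exists_forall_mk_mul_eval (a : FreeAlgebra K (NekGen G X)) :
    ∃ k, ∀ f ∈ lengthGe K S k, mk K S a * eval K S f = eval K S (fock K S a f) := by
  induction a using FreeAlgebra.induction with
  | grade0 c =>
    refine ⟨0, fun f _ => ?_⟩
    rw [AlgHom.commutes, AlgHom.commutes, Module.algebraMap_end_apply, map_smul, Algebra.smul_def]
  | grade1 y =>
    refine ⟨1, fun f hf => ?_⟩
    cases y with
    | letter x => rw [fock_letter, map_mul, eval_of_ofWord_singleton, letter]
    | letterStar x => rw [fock_letterStar, eval_leftDiv_letter x hf, letterStar]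
    | elt g => rw [fock_elt, map_mul, eval_of_ofElt, elt]
    | eltStar g =>
      rw [fock_eltStar, leftDiv_of_mul_eq_one (n := ofElt S g⁻¹), map_mul, eval_of_ofElt,
        mk_eltStar]
      rw [← ofElt_mul, mul_inv_cancel, ofElt_one]
  | mul a b ha hb =>
    obtain ⟨k, hk⟩ := ha
    obtain ⟨l, hl⟩ := hb
    obtain ⟨j, hj⟩ := exists_forall_fock_mem_lengthGe (S := S) b
    refine ⟨k + j + l, fun f hf => ?_⟩
    rw [map_mul, map_mul, mul_assoc, hl f (lengthGe_antitone (by omega) hf),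
      hk _ (hj k f (lengthGe_antitone (by omega) hf)), Module.End.mul_apply]
  | add a b ha hb =>
    obtain ⟨k, hk⟩ := ha
    obtain ⟨l, hl⟩ := hb
    refine ⟨k + l, fun f hf => ?_⟩
    rw [map_add, map_add, add_mul, hk f (lengthGe_antitone (by omega) hf),
      hl f (lengthGe_antitone (by omega) hf), LinearMap.add_apply, map_add]

theorem exists_mul_word_eq_eval (b : NekAlgebra K S) :
    ∃ k, ∀ w : List X, k ≤ w.length → ∃ f, b * word K S w = eval K S f := by
  obtain ⟨a, rfl⟩ := mk_surjective K S b
  obtain ⟨k, hk⟩ := exists_forall_mk_mul_eval (S := S) a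
  refine ⟨k, fun w hw => ⟨fock K S a (.of K _ (ofWord S w)), ?_⟩⟩
  rw [← eval_of_ofWord, hk _ (lengthGe_antitone hw (of_mem_lengthGe (ofWord S w)))]

theorem fockCon_of_mk_eq {a b : FreeAlgebra K (NekGen G X)} (h : mk K S a = mk K S b) :
    fockCon K S a b := by
  let φ : NekAlgebra K S →ₐ[K] (fockCon K S).Quotient :=
    RingQuot.liftAlgHom K ⟨(fockCon K S).mkₐ K, fun _ _ hr =>
      (fockCon K S).eq.2 (fockCon_of_nekRel hr)⟩
  have hφ : ∀ c, φ (mk K S c) = (fockCon K S).mkₐ K c := RingQuot.liftAlgHom_mkAlgHom_apply K _ _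
  exact (fockCon K S).eq.1 ((hφ a).symm.trans ((congrArg φ h).trans (hφ b)))

theorem exists_mk_eq_eval (f : K[S.ZappaSzep]) :
    ∃ a, mk K S a = eval K S f ∧ ∀ g, fock K S a g = f * g := by
  have hmul : ∀ {f g : K[S.ZappaSzep]},
      (∃ a, mk K S a = eval K S f ∧ ∀ r, fock K S a r = f * r) →
      (∃ b, mk K S b = eval K S g ∧ ∀ r, fock K S b r = g * r) →
      ∃ c, mk K S c = eval K S (f * g) ∧ ∀ r, fock K S c r = f * g * r := by
    rintro f g ⟨a, ha, ha'⟩ ⟨b, hb, hb'⟩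
    exact ⟨a * b, by rw [map_mul, map_mul, ha, hb], fun r => by
      rw [map_mul, Module.End.mul_apply, hb', ha', mul_assoc]⟩
  have hword : ∀ w : List X, ∃ a, mk K S a = eval K S (.of K _ (ofWord S w)) ∧
      ∀ r, fock K S a r = .of K _ (ofWord S w) * r := by
    intro w
    induction w with
    | nil => exact ⟨1, by rw [ofWord_nil, map_one, map_one, map_one], fun r => by
        rw [map_one, Module.End.one_apply, ofWord_nil, map_one, one_mul]⟩
    | cons x w ih =>
      rw [ofWord_cons, map_mul]
      exact hmul ⟨_, (eval_of_ofWord_singleton x).symm, fock_letter x⟩ ih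
  induction f using MonoidAlgebra.induction_linear with
  | zero => exact ⟨0, by simp only [map_zero], by simp⟩
  | add f g hf hg =>
    obtain ⟨a, ha, ha'⟩ := hf
    obtain ⟨b, hb, hb'⟩ := hg
    exact ⟨a + b, by rw [map_add, map_add, ha, hb], fun r => by
      rw [map_add, LinearMap.add_apply, ha', hb', add_mul]⟩
  | single m c =>
    obtain ⟨a, ha, ha'⟩ := hmul (hword m.word)
      ⟨_, (eval_of_ofElt m.elt).symm, fock_elt m.elt⟩
    rw [← map_mul, ofWord_mul_ofElt] at ha ha'
    have hsingle : MonoidAlgebra.single m c = c • .of K _ m := by simp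
    exact ⟨c • a, by rw [map_smul, ha, hsingle, map_smul], fun r => by
      rw [map_smul, LinearMap.smul_apply, ha', hsingle, smul_mul_assoc]⟩

theorem eval_eq_zero_iff {f : K[S.ZappaSzep]} :
    eval K S f = 0 ↔ ∃ n, ∀ w : List X, n ≤ w.length → f * .of K _ (ofWord S w) = 0 := by
  constructor
  · intro hf
    obtain ⟨a, ha, hfock⟩ := exists_mk_eq_eval f
    obtain ⟨k, hk⟩ := fockCon_of_mk_eq (S := S) (a := a) (b := 0) (by rw [ha, hf, map_zero])
    refine ⟨k, fun w hw => ?_⟩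
    rw [← hfock, hk _ (lengthGe_antitone hw (of_mem_lengthGe (ofWord S w))), map_zero,
      LinearMap.zero_apply]
  · rintro ⟨n, hn⟩
    refine eq_zero_of_mul_word n fun w hw => ?_
    rw [← eval_of_ofWord, ← map_mul, hn w hw.ge, map_zero]

theorem word_ne_zero [Nonempty X] (w : List X) : word K S w ≠ 0 := by
  intro h
  rw [← eval_of_ofWord] at h
  obtain ⟨n, hn⟩ := eval_eq_zero_iff.1 h
  have hmul := hn (List.replicate n (Classical.arbitrary X)) (by simp)
  rw [← map_mul] at hmul
  simp at hmul

/-- The elements of the Nekrashevych algebra that annihilate, by right multiplication, an open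
dense set of infinite words: those `b` such that every word `p` can be prolonged to a word `p s`
with `b p s = 0`. -/
def IsSingular (b : NekAlgebra K S) : Prop :=
  ∀ p : List X, ∃ s : List X, b * word K S p * word K S s = 0

namespace IsSingular

theorem zero : IsSingular (0 : NekAlgebra K S) := fun _ => ⟨[], by simp only [zero_mul]⟩

theorem add {a b : NekAlgebra K S} (ha : IsSingular a) (hb : IsSingular b) :
    IsSingular (a + b) := by
  intro p
  obtain ⟨s, hs⟩ := ha p
  obtain ⟨t, ht⟩ := hb (p ++ s)
  rw [word_append, ← mul_assoc] at ht
  exact ⟨s ++ t, by rw [word_append, add_mul, add_mul, ← mul_assoc, hs, zero_mul, zero_add,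
    ← mul_assoc, ht]⟩

theorem sum {ι : Type*} (t : Finset ι) {b : ι → NekAlgebra K S} (h : ∀ i ∈ t, IsSingular (b i)) :
    IsSingular (∑ i ∈ t, b i) :=
  Finset.sum_induction b IsSingular (fun _ _ => add) zero h

theorem mul_left (a : NekAlgebra K S) {b : NekAlgebra K S} (hb : IsSingular b) :
    IsSingular (a * b) := by
  intro p
  obtain ⟨s, hs⟩ := hb p
  exact ⟨s, by rw [mul_assoc a, mul_assoc a, hs, mul_zero]⟩

theorem mul_eval {b : NekAlgebra K S} (hb : IsSingular b) (f : K[S.ZappaSzep]) :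
    IsSingular (b * eval K S f) := by
  induction f using MonoidAlgebra.induction_linear with
  | zero => rw [map_zero, mul_zero]; exact zero
  | add f g hf hg => rw [map_add, mul_add]; exact hf.add hg
  | single m c =>
    have hsmul : MonoidAlgebra.single m c = c • .of K _ m := by simp
    rw [hsmul, map_smul, mul_smul_comm, Algebra.smul_def]
    refine mul_left _ fun p => ?_
    obtain ⟨s, hs⟩ := hb (m * ofWord S p).word
    obtain ⟨s, rfl⟩ := (S.toPerm (m * ofWord S p).elt).surjective s
    refine ⟨s, ?_⟩
    rw [mul_assoc b, ← eval_of_ofWord, ← map_mul, ← map_mul, mul_assoc b, ← eval_of_ofWord,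
      ← map_mul, ← map_mul, mul_ofWord, map_mul, map_mul, map_mul, map_mul, eval_of_ofWord,
      eval_of_ofWord, ← mul_assoc, ← mul_assoc, hs, zero_mul]

theorem of_mul_word {b : NekAlgebra K S} (h : ∀ p, ∃ s, IsSingular (b * word K S p * word K S s)) :
    IsSingular b := by
  intro p
  obtain ⟨s, hs⟩ := h p
  obtain ⟨t, ht⟩ := hs []
  exact ⟨s ++ t, by rw [word_append, ← mul_assoc, ← ht, word_nil, mul_one]⟩

theorem mul_right [Nonempty X] {b : NekAlgebra K S} (hb : IsSingular b) (a : NekAlgebra K S) :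
    IsSingular (b * a) := by
  refine of_mul_word fun p => ?_
  obtain ⟨k, hk⟩ := exists_mul_word_eq_eval (a * word K S p)
  obtain ⟨f, hf⟩ := hk (List.replicate k (Classical.arbitrary X)) (by simp)
  exact ⟨_, by rw [mul_assoc b, mul_assoc b, hf]; exact hb.mul_eval f⟩

theorem of_wordStar_mul (n : ℕ) {b : NekAlgebra K S}
    (h : ∀ q : List X, q.length = n → IsSingular (wordStar K S q * b)) : IsSingular b := by
  induction n generalizing b with
  | zero => simpa only [wordStar_nil, one_mul] using h [] rfl
  | succ n ih =>
    have hletterStar : ∀ x, IsSingular (letterStar K S x * b) := fun x => ih fun q hq => by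
      rw [← mul_assoc, ← wordStar_cons]
      exact h _ (by simp [hq])
    rw [← one_mul b, ← sum_letter_mul_letterStar, Finset.sum_mul]
    exact sum _ fun x _ => by rw [mul_assoc]; exact (hletterStar x).mul_left _

theorem exists_forall_mul_ofWord_eq_zero [Nonempty X] {ι : Type*} [Finite ι] {f : K[S.ZappaSzep]}
    (hf : IsSingular (eval K S f)) (p : ι → List X) :
    ∃ s, ∀ i, f * .of K _ (ofWord S (p i ++ s)) = 0 := by
  have hsingle : ∀ q, ∃ s, f * .of K _ (ofWord S (q ++ s)) = 0 := fun q => by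
    obtain ⟨s, hs⟩ := hf q
    rw [mul_assoc, ← word_append, ← eval_of_ofWord, ← map_mul] at hs
    obtain ⟨n, hn⟩ := eval_eq_zero_iff.1 hs
    refine ⟨s ++ List.replicate n (Classical.arbitrary X), ?_⟩
    rw [← List.append_assoc, ofWord_append, map_mul, ← mul_assoc]
    exact hn _ (by simp)
  suffices hfinset : ∀ t : Finset ι, ∃ s, ∀ i ∈ t, f * .of K _ (ofWord S (p i ++ s)) = 0 by
    have := Fintype.ofFinite ι
    simpa using hfinset Finset.univ
  classical
  intro t
  induction t using Finset.induction_on with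
  | empty => exact ⟨[], by simp⟩
  | insert i t _ ih =>
    obtain ⟨s, hs⟩ := ih
    obtain ⟨r, hr⟩ := hsingle (p i ++ s)
    rw [List.append_assoc] at hr
    refine ⟨s ++ r, Finset.forall_mem_insert _ _ _ |>.2 ⟨hr, fun j hj => ?_⟩⟩
    rw [← List.append_assoc, ofWord_append, map_mul, ← mul_assoc, hs j hj, zero_mul]

end IsSingular

theorem not_isSingular_one [Nonempty X] : ¬ IsSingular (1 : NekAlgebra K S) := by
  intro h
  obtain ⟨s, hs⟩ := h []
  exact word_ne_zero s (by simpa only [word_nil, one_mul] using hs)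

variable (K S) in
/-- The ideal of singular elements. -/
noncomputable def singularIdeal [Nonempty X] : TwoSidedIdeal (NekAlgebra K S) :=
  .mk' {b | IsSingular b} IsSingular.zero IsSingular.add
    (fun {b} hb => by rw [← neg_one_mul]; exact IsSingular.mul_left (-1) hb)
    (fun hb => hb.mul_left _) (fun hb => hb.mul_right _)

theorem mem_singularIdeal [Nonempty X] {b : NekAlgebra K S} :
    b ∈ singularIdeal K S ↔ IsSingular b :=
  TwoSidedIdeal.mem_mk' _ _ _ _ _ _ _

section Persistent

variable {I : TwoSidedIdeal (NekAlgebra K S)} {f : K[S.ZappaSzep]}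

/-- Formal combinations of elements `u g` whose value lies in the ideal `I` and is not annihilated
by right multiplication with any word. One with smallest support is a monomial, and its value is
left invertible. -/
def IsPersistent (I : TwoSidedIdeal (NekAlgebra K S)) (f : K[S.ZappaSzep]) : Prop :=
  eval K S f ∈ I ∧ ∀ s, eval K S f * word K S s ≠ 0

theorem IsPersistent.mul_ofWord (hf : IsPersistent I f) (w : List X) :
    IsPersistent I (f * .of K _ (ofWord S w)) := by
  rw [IsPersistent, map_mul, eval_of_ofWord]
  exact ⟨I.mul_mem_right _ _ hf.1, fun s => by rw [mul_assoc, ← word_append]; exact hf.2 _⟩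

theorem IsPersistent.not_isSingular (hf : IsPersistent I f) : ¬ IsSingular (eval K S f) := by
  intro h
  obtain ⟨s, hs⟩ := h []
  exact hf.2 s (by simpa only [word_nil, mul_one] using hs)

theorem exists_isPersistent [Nonempty X] {b : NekAlgebra K S} (hb : b ∈ I)
    (hb' : ¬ IsSingular b) : ∃ f, IsPersistent I f := by
  obtain ⟨p, hp⟩ : ∃ p, ∀ s, b * word K S p * word K S s ≠ 0 := by
    simpa only [IsSingular, not_forall, not_exists] using hb'
  obtain ⟨k, hk⟩ := exists_mul_word_eq_eval (b * word K S p)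
  obtain ⟨f, hf⟩ := hk (List.replicate k (Classical.arbitrary X)) (by simp)
  refine ⟨f, ?_, fun s => ?_⟩
  · rw [← hf]
    exact I.mul_mem_right _ _ (I.mul_mem_right _ _ hb)
  · rw [← hf, mul_assoc, ← word_append]
    exact hp _

theorem IsPersistent.exists_leftDiv [Nonempty X] (hf : IsPersistent I f) (n : ℕ) :
    ∃ q p : List X, q.length = n ∧
      IsPersistent I (leftDiv (ofWord S q) (f * .of K _ (ofWord S p))) := by
  set w := List.replicate n (Classical.arbitrary X) with hw
  obtain ⟨q, hq, hsing⟩ : ∃ q : List X, q.length = n ∧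
      ¬ IsSingular (wordStar K S q * eval K S (f * .of K _ (ofWord S w))) := by
    by_contra! h
    exact (hf.mul_ofWord w).not_isSingular (.of_wordStar_mul n h)
  obtain ⟨p, hp⟩ : ∃ p, ∀ s, wordStar K S q * eval K S (f * .of K _ (ofWord S w)) *
      word K S p * word K S s ≠ 0 := by
    simpa only [IsSingular, not_forall, not_exists] using hsing
  have hlength : f * .of K _ (ofWord S (w ++ p)) ∈ lengthGe K S q.length :=
    mul_mem_lengthGe_right _ (lengthGe_antitone (by simp [hq, hw]) (of_mem_lengthGe _))
  refine ⟨q, w ++ p, hq, ?_, fun s => ?_⟩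
  · rw [eval_leftDiv_ofWord q hlength]
    exact I.mul_mem_left _ _ (hf.mul_ofWord _).1
  · rw [eval_leftDiv_ofWord q hlength, ofWord_append, map_mul (MonoidAlgebra.of K _),
      ← mul_assoc f, map_mul (eval K S), eval_of_ofWord p, ← mul_assoc]
    exact hp s

theorem IsPersistent.prefix_of_minimal [Nonempty X] (hf : IsPersistent I f)
    (hmin : ∀ g, IsPersistent I g → f.coeff.support.card ≤ g.coeff.support.card)
    {m n : S.ZappaSzep} (hm : m ∈ f.coeff.support) (hn : n ∈ f.coeff.support)
    (hmn : m.word.length ≤ n.word.length) (s : List X) :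
    (m * ofWord S s).word <+: (n * ofWord S s).word := by
  obtain ⟨q, p, hq, hdiv⟩ := (hf.mul_ofWord s).exists_leftDiv (m * ofWord S s).word.length
  rw [mul_assoc, ← map_mul] at hdiv
  have hcard := hmin _ hdiv
  have hle := card_support_leftDiv_le (ofWord S q) (f * .of K _ (ofWord S s * ofWord S p))
  have hprefix : ∀ r ∈ f.coeff.support, q <+: (r * ofWord S s * ofWord S p).word := fun r hr => by
    rw [← exists_eq_ofWord_mul_iff, mul_assoc]
    exact exists_eq_mul_of_card_support_leftDiv ((card_support_mul_of_le _ _).trans hcard)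
      (mul_mem_support_mul_of (hcard.trans hle) hr)
  have hqm : q <+: (m * ofWord S s).word :=
    List.prefix_of_prefix_length_le (hprefix m hm) (List.prefix_append _ _) hq.le
  have hqn : q <+: (n * ofWord S s).word :=
    List.prefix_of_prefix_length_le (hprefix n hn) (List.prefix_append _ _)
      (by simpa only [hq, length_word_mul, add_le_add_iff_right] using hmn)
  rwa [← hqm.eq_of_length hq]

theorem IsPersistent.exists_eq_smul_of_minimal [Nontrivial X] (hf : IsPersistent I f)
    (hmin : ∀ g, IsPersistent I g → f.coeff.support.card ≤ g.coeff.support.card) :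
    ∃ c : K, ∃ m, c ≠ 0 ∧ f = c • .of K _ m := by
  obtain ⟨m, hm⟩ : f.coeff.support.Nonempty := by
    rw [Finsupp.support_nonempty_iff]
    intro h0
    exact hf.2 [] (by rw [MonoidAlgebra.coeff_eq_zero.1 h0, map_zero, zero_mul])
  have hunique : ∀ n ∈ f.coeff.support, n = m := fun n hn => by
    by_contra hne
    rcases le_total n.word.length m.word.length with hle | hle
    · obtain ⟨s, hs⟩ := exists_not_prefix_mul_ofWord hne
      exact hs (hf.prefix_of_minimal hmin hn hm hle s)
    · obtain ⟨s, hs⟩ := exists_not_prefix_mul_ofWord (Ne.symm hne)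
      exact hs (hf.prefix_of_minimal hmin hm hn hle s)
  refine ⟨f.coeff m, m, Finsupp.mem_support_iff.1 hm, ?_⟩
  have hsupport : f.coeff.support ⊆ {m} := fun n hn => Finset.mem_singleton.2 (hunique n hn)
  rw [MonoidAlgebra.of_apply, MonoidAlgebra.smul_single, smul_eq_mul, mul_one]
  exact MonoidAlgebra.coeff_injective (Finsupp.support_subset_singleton.1 hsupport)

theorem IsPersistent.one_mem [Nontrivial X] (hf : IsPersistent I f) : (1 : NekAlgebra K S) ∈ I := by
  let card (f : K[S.ZappaSzep]) : ℕ := f.coeff.support.card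
  have hI : {f | IsPersistent I f}.Nonempty := ⟨f, hf⟩
  have hargmin : IsPersistent I (Function.argminOn card _ hI) := Function.argminOn_mem card _ hI
  obtain ⟨c, m, hc, hcm⟩ := hargmin.exists_eq_smul_of_minimal fun g hg =>
    Function.argminOn_le card _ hg
  have hmem := hargmin.1
  rw [hcm, map_smul, ← ofWord_mul_ofElt m, map_mul, map_mul, eval_of_ofWord, eval_of_ofElt] at hmem
  have hinv : c⁻¹ • (elt K S m.elt⁻¹ * (wordStar K S m.word *
      (c • (word K S m.word * elt K S m.elt)))) = 1 := by
    rw [mul_smul_comm, mul_smul_comm, inv_smul_smul₀ hc, ← mul_assoc (wordStar K S m.word),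
      wordStar_mul_word_self, one_mul, ← elt_mul, inv_mul_cancel, elt_one]
  rw [← hinv, Algebra.smul_def]
  exact I.mul_mem_left _ _ (I.mul_mem_left _ _ (I.mul_mem_left _ _ hmem))

end Persistent

theorem isSimpleRing_iff_forall_isSingular [Nontrivial X] :
    IsSimpleRing (NekAlgebra K S) ↔ ∀ b : NekAlgebra K S, IsSingular b → b = 0 := by
  constructor
  · intro _ b hb
    rw [← mem_singularIdeal] at hb
    rcases eq_bot_or_eq_top (singularIdeal K S) with hbot | htop
    · rwa [hbot, TwoSidedIdeal.mem_bot] at hb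
    · exact absurd (mem_singularIdeal.1 (htop ▸ trivial)) (not_isSingular_one (K := K) (S := S))
  · intro h
    have : Nontrivial (NekAlgebra K S) := ⟨1, 0, fun h10 =>
      not_isSingular_one (K := K) (S := S) (h10 ▸ .zero)⟩
    refine ⟨⟨fun I => or_iff_not_imp_left.2 fun hI => ?_⟩⟩
    obtain ⟨b, hb, hb0⟩ : ∃ b ∈ I, b ≠ 0 := by
      by_contra! hzero
      exact hI (eq_bot_iff.2 fun b hb => hzero b hb)
    obtain ⟨f, hf⟩ := exists_isPersistent hb (mt (h b) hb0)
    exact I.one_mem_iff.1 hf.one_mem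

end NekAlgebra

namespace Automaton

variable {S : SelfSimilarAction G X} (A : Automaton S)

section Graph

theorem eqv_iff {w : List X} {g h : A.states} :
    A.eqv w g h ↔ ofElt S g * ofWord S w = ofElt S h * ofWord S w := by
  suffices heqv : A.eqv w g h ↔
      S.toPerm g w = S.toPerm h w ∧ S.secWord g w = S.secWord h w by
    simpa [ZappaSzep.ext_iff] using heqv
  induction w generalizing g h with
  | nil =>
    change g = h ↔ _
    rw [toPerm_nil, toPerm_nil, eq_self, true_and]
    exact Subtype.ext_iff
  | cons x w ih =>
    change S.letter g x = S.letter h x ∧ A.eqv w (A.next g x) (A.next h x) ↔ _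
    rw [ih, map_cons, map_cons, secWord, secWord, List.cons.injEq, and_assoc]
    rfl

/-- The vertex `≡_w` of the simplicity graph. -/
def vertex (w : List X) : A.Vertex := ⟨A.eqv w, w, rfl⟩

theorem exists_eq_vertex (v : A.Vertex) : ∃ w, v = A.vertex w :=
  v.exists_word.imp fun _ hw => Vertex.ext hw

instance : Finite A.Vertex :=
  Finite.of_injective (fun v : A.Vertex => v.rel.r) fun _ _ h =>
    Vertex.ext (Setoid.ext fun _ _ => iff_of_eq (congrFun₂ h _ _))

variable {A}

theorem edge_vertex_iff {w : List X} {v : A.Vertex} :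
    A.Edge (A.vertex w) v ↔ ∃ x, v = A.vertex (x :: w) :=
  exists_congr fun x => (Vertex.ext_iff (x := v) (y := A.vertex (x :: w))).symm

theorem reaches_vertex_iff {w : List X} {v : A.Vertex} :
    A.Reaches (A.vertex w) v ↔ ∃ u, v = A.vertex (u ++ w) := by
  constructor
  · intro h
    induction h with
    | refl => exact ⟨[], rfl⟩
    | tail _ hedge ih =>
      obtain ⟨u, rfl⟩ := ih
      obtain ⟨x, hx⟩ := edge_vertex_iff.1 hedge
      exact ⟨x :: u, hx⟩
  · rintro ⟨u, rfl⟩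
    induction u with
    | nil => exact .refl
    | cons x u ih => exact ih.tail (edge_vertex_iff.2 ⟨x, rfl⟩)

theorem transGen_edge_vertex_iff {w : List X} {v : A.Vertex} :
    Relation.TransGen A.Edge (A.vertex w) v ↔ ∃ u ≠ [], v = A.vertex (u ++ w) := by
  rw [Relation.TransGen.tail'_iff]
  constructor
  · rintro ⟨v', hreaches, hedge⟩
    obtain ⟨u, rfl⟩ := reaches_vertex_iff.1 hreaches
    obtain ⟨x, rfl⟩ := edge_vertex_iff.1 hedge
    exact ⟨x :: u, List.cons_ne_nil x u, rfl⟩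
  · rintro ⟨- | ⟨x, u⟩, hu, rfl⟩
    · exact absurd rfl hu
    · exact ⟨_, reaches_vertex_iff.2 ⟨u, rfl⟩, edge_vertex_iff.2 ⟨x, rfl⟩⟩

theorem vertex_append_congr {w w' : List X} (u : List X) (h : A.vertex w = A.vertex w') :
    A.vertex (u ++ w) = A.vertex (u ++ w') := by
  induction u with
  | nil => exact h
  | cons x u ih => exact Vertex.ext (congrArg (fun v : A.Vertex => A.dot x v.rel) ih)

theorem exists_forall_eq_vertex_append {v v' : A.Vertex} (h : A.Reaches v v') :
    ∃ p, ∀ w, v = A.vertex w → v' = A.vertex (p ++ w) := by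
  obtain ⟨w, rfl⟩ := A.exists_eq_vertex v
  obtain ⟨p, rfl⟩ := reaches_vertex_iff.1 h
  exact ⟨p, fun _ hw => vertex_append_congr p hw⟩

theorem mem_Vmin_iff {v : A.Vertex} : v ∈ A.Vmin ↔ ∀ v', A.Reaches v v' → A.Reaches v' v := by
  refine ⟨fun h v' hv' => ?_, fun h c hc => ?_⟩
  · exact toAntisymmetrization_le_toAntisymmetrization_iff.1
      (h (toAntisymmetrization_le_toAntisymmetrization_iff.2 hv' : A.component v' ≤ A.component v))
  · induction c using Antisymmetrization.ind with
    | _ v' =>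
      exact toAntisymmetrization_le_toAntisymmetrization_iff.2
        (h v' (toAntisymmetrization_le_toAntisymmetrization_iff.1 hc))

theorem mem_Vmin_of_reaches {v v' : A.Vertex} (hv : v ∈ A.Vmin) (h : A.Reaches v v') :
    v' ∈ A.Vmin :=
  mem_Vmin_iff.2 fun v'' hv'' => (mem_Vmin_iff.1 hv v'' (h.trans hv'')).trans h

variable (A) in
theorem exists_mem_Vmin : ∃ v, v ∈ A.Vmin := by
  obtain ⟨v, -, hv⟩ := (Set.finite_univ (α := A.Vertex)).exists_minimal ⟨A.vertex [], trivial⟩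
  exact ⟨v, mem_Vmin_iff.2 fun _ hv' => hv trivial hv'⟩

theorem exists_eq_vertex_of_mem_Vess {v : A.Vertex} (hv : v ∈ A.Vess) (n : ℕ) :
    ∃ w : List X, n ≤ w.length ∧ v = A.vertex w := by
  obtain ⟨c, hcycle, hreaches⟩ := hv
  obtain ⟨w, hw, rfl⟩ : ∃ w : List X, n ≤ w.length ∧ c = A.vertex w := by
    obtain ⟨w, rfl⟩ := A.exists_eq_vertex c
    obtain ⟨r, hr, hrw⟩ := transGen_edge_vertex_iff.1 hcycle
    clear hreaches
    induction n with
    | zero => exact ⟨w, Nat.zero_le _, rfl⟩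
    | succ n ih =>
      obtain ⟨t, ht, hwt⟩ := ih
      refine ⟨r ++ t, ?_, hrw.trans (vertex_append_congr r hwt)⟩
      have := List.length_pos_iff.2 hr
      rw [List.length_append]
      omega
  obtain ⟨u, rfl⟩ := reaches_vertex_iff.1 hreaches
  exact ⟨u ++ w, by rw [List.length_append]; omega, rfl⟩

theorem vertex_mem_Vess {w : List X} (hw : Nat.card A.Vertex ≤ w.length) :
    A.vertex w ∈ A.Vess := by
  obtain ⟨i, j, hij, hvertex⟩ : ∃ i j : Fin (w.length + 1), i < j ∧
      A.vertex (w.drop i) = A.vertex (w.drop j) := by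
    by_contra! hne
    have hinj : Function.Injective fun i : Fin (w.length + 1) => A.vertex (w.drop i) :=
      .of_lt_imp_ne hne
    have := Nat.card_le_card_of_injective _ hinj
    rw [Nat.card_fin] at this
    omega
  refine ⟨A.vertex (w.drop j), ?_, reaches_vertex_iff.2 ⟨w.take j, by rw [List.take_append_drop]⟩⟩
  refine transGen_edge_vertex_iff.2 ⟨(w.drop i).take (j - i), ?_, ?_⟩
  · refine List.ne_nil_of_length_pos ?_
    rw [List.length_take, List.length_drop]
    omega
  · have hdrop : w.drop j = (w.drop i).drop (j - i) := by
      rw [List.drop_drop, Nat.add_sub_cancel' hij.le]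
    conv_rhs => rw [hdrop, List.take_append_drop]
    exact hvertex.symm

end Graph

theorem isAttracting_of_nucleus_subset (hS : S.IsContracting) (hA : S.nucleus ⊆ A.states) :
    S.IsAttracting A.states :=
  ⟨A.states.finite_toSet, A.sectionClosed, fun g =>
    ((S.nucleus_isLeast hS).1.2.2 g).imp fun _ hn w hw => hA (hn w hw)⟩

variable {A}

section System

variable {K : Type*} [Field K]

theorem isSolution_systemS_iff {c : A.states → K} :
    IsSolution A.systemS c ↔ ∀ v ∈ A.Vmin, IsSolution (A.system v.rel) c := by
  simp only [IsSolution, systemS, Set.mem_iUnion]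
  exact ⟨fun h v hv e he => h e ⟨v, hv, he⟩, fun h e ⟨v, hv, he⟩ => h v hv e he⟩

variable (A K) in
/-- The span of the elements `u g` of the Zappa–Szép product whose group element `g` is a state. -/
noncomputable def stateSpan : Submodule K K[S.ZappaSzep] :=
  MonoidAlgebra.supported K K {m | m.elt ∈ A.states}

variable (A) in
/-- The coefficients of a formal combination at the elements `u g`, for a fixed word `u`. -/
def coeffAt (f : K[S.ZappaSzep]) (u : List X) (g : A.states) : K := f.coeff ⟨u, g⟩

variable (A) in
/-- The formal sum `∑ c_g g` over the states of the automaton. -/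
noncomputable def formalSum (c : A.states → K) : K[S.ZappaSzep] :=
  ∑ g : A.states, .single (ofElt S g) (c g)

theorem formalSum_mem_stateSpan (c : A.states → K) : A.formalSum c ∈ A.stateSpan K := by
  classical
  refine Submodule.sum_mem _ fun g _ m hm => ?_
  obtain rfl : m = ofElt S g := by simpa using Finsupp.support_single_subset hm
  exact g.2

theorem coeffAt_formalSum (c : A.states → K) (u : List X) :
    A.coeffAt (A.formalSum c) u = if u = [] then c else 0 := by
  classical
  ext g
  simp only [coeffAt, formalSum, MonoidAlgebra.coeff_sum, Finsupp.finsetSum_apply]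
  by_cases hu : u = []
  · subst hu
    rw [Finset.sum_eq_single_of_mem g (Finset.mem_univ g)]
    · simp [ofElt]
    · intro h _ hne
      simp [ofElt, ZappaSzep.ext_iff, Subtype.ext_iff.not.1 hne]
  · simp [ofElt, ZappaSzep.ext_iff, hu]

theorem forall_isSolution_coeffAt_formalSum {E : Set (A.states → ℤ)} {c : A.states → K} :
    (∀ u, IsSolution E (A.coeffAt (A.formalSum c) u)) ↔ IsSolution E c := by
  simp only [coeffAt_formalSum]
  refine ⟨fun h => h [], fun h u => ?_⟩
  split_ifs
  · exact h
  · exact fun e _ => by simp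

open Classical in
theorem coeff_mul_ofWord {f : K[S.ZappaSzep]} (hf : f ∈ A.stateSpan K) (u w : List X)
    (h : A.states) :
    (f * .of K _ (ofWord S w)).coeff (⟨u, h⟩ * ofWord S w) =
      ∑ g, ((if A.eqv w g h then 1 else 0 : ℤ) : K) * A.coeffAt f u g := by
  have hsum : ∑ g, ((if A.eqv w g h then 1 else 0 : ℤ) : K) * A.coeffAt f u g =
      ∑ g with A.eqv w g h, A.coeffAt f u g := by
    simp [Finset.sum_filter]
  rw [hsum, coeff_mul_of]
  refine Finset.sum_bij_ne_zero (fun m hm _ => ⟨m.elt, hf (Finset.mem_filter.1 hm).1⟩) ?_ ?_ ?_ ?_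
  · intro m hm _
    exact Finset.mem_filter.2 ⟨Finset.mem_univ _,
      A.eqv_iff.2 (mul_ofWord_eq_mul_ofWord_iff.1 (Finset.mem_filter.1 hm).2).2⟩
  · intro m hm _ n hn _ hmn
    refine ZappaSzep.ext ?_ (congrArg Subtype.val hmn)
    exact (mul_ofWord_eq_mul_ofWord_iff.1 (Finset.mem_filter.1 hm).2).1.trans
      (mul_ofWord_eq_mul_ofWord_iff.1 (Finset.mem_filter.1 hn).2).1.symm
  · intro g hg hne
    refine ⟨⟨u, g⟩, Finset.mem_filter.2 ⟨Finsupp.mem_support_iff.2 hne, ?_⟩, hne, rfl⟩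
    exact mul_ofWord_eq_mul_ofWord_iff.2 ⟨rfl, A.eqv_iff.1 (Finset.mem_filter.1 hg).2⟩
  · intro m hm _
    obtain rfl := (mul_ofWord_eq_mul_ofWord_iff.1 (Finset.mem_filter.1 hm).2).1
    rfl

theorem mul_ofWord_eq_zero_iff {f : K[S.ZappaSzep]} (hf : f ∈ A.stateSpan K) {w : List X} :
    f * .of K _ (ofWord S w) = 0 ↔ ∀ u, IsSolution (A.system (A.eqv w)) (A.coeffAt f u) := by
  classical
  constructor
  · rintro hzero u _ ⟨h, rfl⟩
    rw [← coeff_mul_ofWord hf, hzero]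
    rfl
  · intro hsol
    ext m
    by_cases hm : ∃ a ∈ f.coeff.support, a * ofWord S w = m
    · obtain ⟨⟨u, h⟩, ha, rfl⟩ := hm
      exact (coeff_mul_ofWord hf u w ⟨h, hf ha⟩).trans (hsol u _ ⟨⟨h, hf ha⟩, rfl⟩)
    · push Not at hm
      rw [coeff_mul_of, Finset.filter_false_of_mem hm, Finset.sum_empty]
      rfl

theorem eval_eq_zero_iff [Fintype X] {f : K[S.ZappaSzep]} (hf : f ∈ A.stateSpan K) :
    NekAlgebra.eval K S f = 0 ↔
      ∀ u, ∀ v ∈ A.Vess, IsSolution (A.system v.rel) (A.coeffAt f u) := by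
  rw [NekAlgebra.eval_eq_zero_iff]
  constructor
  · rintro ⟨n, hn⟩ u v hv
    obtain ⟨w, hw, rfl⟩ := exists_eq_vertex_of_mem_Vess hv n
    exact (mul_ofWord_eq_zero_iff hf).1 (hn w hw) u
  · exact fun h => ⟨Nat.card A.Vertex, fun w hw =>
      (mul_ofWord_eq_zero_iff hf).2 fun u => h u _ (vertex_mem_Vess hw)⟩

theorem isSingular_eval_iff [Fintype X] [Nonempty X] {f : K[S.ZappaSzep]}
    (hf : f ∈ A.stateSpan K) :
    NekAlgebra.IsSingular (NekAlgebra.eval K S f) ↔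
      ∀ u, IsSolution A.systemS (A.coeffAt f u) := by
  simp only [isSolution_systemS_iff]
  constructor
  · intro hsing u v hv
    -- The word `p` that leads back to `v` from the end of the path `s` depends on `s`, so `s` has
    -- to be chosen for all the finitely many possible `p` at once.
    choose p hp using fun v' : {v' // A.Reaches v v'} =>
      exists_forall_eq_vertex_append (mem_Vmin_iff.1 hv v'.1 v'.2)
    obtain ⟨s, hs⟩ := hsing.exists_forall_mul_ofWord_eq_zero p
    obtain ⟨w, rfl⟩ := A.exists_eq_vertex v
    rw [hp ⟨A.vertex (s ++ w), reaches_vertex_iff.2 ⟨s, rfl⟩⟩ (s ++ w) rfl]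
    refine (mul_ofWord_eq_zero_iff hf).1 ?_ u
    rw [← List.append_assoc, ofWord_append, map_mul, ← mul_assoc, hs, zero_mul]
  · intro h p
    obtain ⟨v, hv⟩ := A.exists_mem_Vmin
    obtain ⟨s, rfl⟩ := A.exists_eq_vertex v
    refine ⟨s, ?_⟩
    have hmin := mem_Vmin_of_reaches hv (reaches_vertex_iff.2 ⟨p, rfl⟩)
    have hzero := (mul_ofWord_eq_zero_iff hf).2 fun u => h u _ hmin
    rw [mul_assoc, ← NekAlgebra.word_append, ← NekAlgebra.eval_of_ofWord, ← map_mul, hzero,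
      map_zero]

end System

theorem exists_mul_ofWord_mem_stateSpan {K : Type*} [Field K] (hA : S.IsAttracting A.states)
    (f : K[S.ZappaSzep]) :
    ∃ n, ∀ s : List X, n ≤ s.length → f * .of K _ (ofWord S s) ∈ A.stateSpan K := by
  classical
  obtain ⟨n, hn⟩ := S.exists_forall_secWord_mem hA (f.coeff.support.image elt)
  refine ⟨n, fun s hs m hm => ?_⟩
  obtain ⟨a, ha, rfl⟩ :=
    Finset.mem_image.1 (MonoidAlgebra.support_coeff_mul_single_subset f 1 (ofWord S s) hm)
  simpa using hn _ (Finset.mem_image_of_mem elt ha) s hs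

theorem isSimpleRing_iff_forall_stateSpan [Fintype X] [Nontrivial X] {K : Type*} [Field K]
    (hA : S.IsAttracting A.states) :
    IsSimpleRing (NekAlgebra K S) ↔ ∀ f ∈ A.stateSpan K,
      NekAlgebra.IsSingular (NekAlgebra.eval K S f) → NekAlgebra.eval K S f = 0 := by
  rw [NekAlgebra.isSimpleRing_iff_forall_isSingular]
  refine ⟨fun h f _ => h _, fun h b hb => ?_⟩
  obtain ⟨k, hk⟩ := NekAlgebra.exists_mul_word_eq_eval b
  refine NekAlgebra.eq_zero_of_mul_word k fun w hw => ?_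
  obtain ⟨f, hf⟩ := hk w hw.ge
  obtain ⟨n, hn⟩ := exists_mul_ofWord_mem_stateSpan hA f
  refine NekAlgebra.eq_zero_of_mul_word n fun s hs => ?_
  have heval : b * NekAlgebra.word K S w * NekAlgebra.word K S s =
      NekAlgebra.eval K S (f * .of K _ (ofWord S s)) := by
    rw [hf, map_mul, NekAlgebra.eval_of_ofWord]
  rw [heval]
  refine h _ (hn s hs.ge) ?_
  rw [← heval]
  exact (hb.mul_right _).mul_right _

end Automaton

end SelfSimilarAction

open SelfSimilarAction Automaton in
theorem theoremt {G X : Type*} [Group G] [Fintype X] (hX : 2 ≤ Fintype.card X)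
    (S : SelfSimilarAction G X) (hS : S.IsContracting) (K : Type*) [Field K]
    (A : SelfSimilarAction.Automaton S) (hA : S.nucleus ⊆ (A.states : Set G)) :
    IsSimpleRing (SelfSimilarAction.NekAlgebra K S) ↔
      ∀ v : A.Vertex, v ∈ A.Vess → v ∉ A.Vmin → IsConsequence K (A.system v.rel) A.systemS := by
  have : Nontrivial X := Fintype.one_lt_card_iff_nontrivial.1 hX
  rw [isSimpleRing_iff_forall_stateSpan (A.isAttracting_of_nucleus_subset hS hA)]
  constructor
  · intro hsimple v hv _ c hc
    have hmem := formalSum_mem_stateSpan c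
    have hzero := hsimple _ hmem
      ((isSingular_eval_iff hmem).2 (forall_isSolution_coeffAt_formalSum.2 hc))
    exact forall_isSolution_coeffAt_formalSum.1 fun u => (eval_eq_zero_iff hmem).1 hzero u v hv
  · intro hcons f hf hsing
    have hsol := (isSingular_eval_iff hf).1 hsing
    refine (eval_eq_zero_iff hf).2 fun u v hv => ?_
    by_cases hmin : v ∈ A.Vmin
    · exact isSolution_systemS_iff.1 (hsol u) v hmin
    · exact hcons v hv hmin _ (hsol u)
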